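/- Let $d\ge 1$, $\alpha>0$ and $\kappa>-1$, and let $Q$ be the transition matrix of simple random walk on $\mathbb{Z}^d$, i.e. $Q(x,y)=\frac1{2d}$ if $|x-y|_1=1$ and $Q(x,y)=0$ otherwise. A (non-trivial discrete) based loop is a tuple $(x_1,\dots,x_n)$ of points of $\mathbb{Z}^d$ with $n\ge 2$ and $x_1\ne x_2,\dots,x_{n-1}\neq x_n, x_n\ne x_1$; a loop is an equivalence class of based loops under circular permutation. Give each based loop the weight $$\dot\mu_\kappa(x_1,\dots,x_n)=\frac1n\Big(\frac1{1+\kappa}\Big)^n Q(x_1,x_2)\cdots Q(x_{n-1},x_n)\,Q(x_n,x_1),$$ and let $\mu_\kappa$ be the push-forward of $\dot\mu_\kappa$ to the space of loops. Let $\mathcal L_{\alpha,\kappa}$ be the Poisson loop ensemble of intensity $\alpha\mu_\kappa$, i.e. a random countable collection of loops (with multiplicities), defined on some probability space, whose point measure $\sum_{\ell\in\mathcal L_{\alpha,\kappa}}\delta_\ell$ is a Poisson random measure of intensity $\alpha\mu_\kappa$. Call an edge of the nearest-neighbour graph $\mathbb{Z}^d$ open if it is traversed by at least one loop of $\mathcal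 L_{\alpha,\kappa}$, and call the vertex sets of the connected components of the graph of open edges the open clusters. Then almost surely there is at most one infinite open cluster. In particular (case $\kappa=0$), this holds for the loop soup $\mathcal L_\alpha=\mathcal L_{\alpha,0}$ of simple random walk on $\mathbb{Z}^d$. -/

import Mathlib

open MeasureTheory ProbabilityTheory
open scoped ENNReal

noncomputable section

namespace LoopSoup

/-- The nearest-neighbour graph on `ℤ^d`: two points are adjacent iff their `ℓ¹`-distance is `1`. -/
def lattice (d : ℕ) : SimpleGraph (Fin d → ℤ) where
  Adj x y := ∑ i, |x i - y i| = 1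
  symm := ⟨fun x y h => by simpa only [abs_sub_comm] using h⟩
  loopless := ⟨fun x h => by simp at h⟩

open Classical in
/-- The transition matrix of simple random walk on `ℤ^d`. -/
def srw (d : ℕ) (x y : Fin d → ℤ) : ℝ :=
  if (lattice d).Adj x y then 1 / (2 * (d : ℝ)) else 0

/-- Non-trivial discrete based loops: tuples `(x₁, …, xₙ)`, `n ≥ 2`, with
`x₁ ≠ x₂, …, xₙ₋₁ ≠ xₙ, xₙ ≠ x₁`. -/
def BasedLoop (V : Type*) : Type _ :=
  {l : List V // 2 ≤ l.length ∧ List.Forall₂ (fun x y => x ≠ y) l (l.rotate 1)}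

/-- The steps `(x₁, x₂), …, (xₙ₋₁, xₙ), (xₙ, x₁)` of a based loop. -/
def BasedLoop.steps {V : Type*} (b : BasedLoop V) : List (V × V) :=
  b.1.zip (b.1.rotate 1)

/-- Two based loops are equivalent if they coincide after a circular permutation. -/
instance BasedLoop.setoid (V : Type*) : Setoid (BasedLoop V) :=
  (List.IsRotated.setoid V).comap Subtype.val

/-- Non-trivial discrete loops: based loops up to circular permutation. -/
def Loop (V : Type*) : Type _ := Quotient (BasedLoop.setoid V)

/-- The projection from based loops to loops. -/
def BasedLoop.toLoop {V : Type*} (b : BasedLoop V) : Loop V := Quotient.mk _ b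

/-- The loop `ℓ` traverses the undirected edge `e`. -/
def Loop.Traverses {V : Type*} (ℓ : Loop V) (e : Sym2 V) : Prop :=
  ∃ b : BasedLoop V, b.toLoop = ℓ ∧ ∃ p ∈ b.steps, s(p.1, p.2) = e

instance (V : Type*) : MeasurableSpace (BasedLoop V) := ⊤

instance (V : Type*) : MeasurableSpace (Loop V) := ⊤

/-- The weight `(1/n) (1/(1+κ))^n Q(x₁,x₂) ⋯ Q(xₙ₋₁,xₙ) Q(xₙ,x₁)` of a based loop. -/
def BasedLoop.weight {V : Type*} (Q : V → V → ℝ) (κ : ℝ) (b : BasedLoop V) : ℝ :=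
  1 / (b.1.length : ℝ) * (1 / (1 + κ)) ^ b.1.length * (b.steps.map fun p => Q p.1 p.2).prod

/-- The based loop measure, giving mass `weight Q κ b` to each based loop `b`. -/
def basedLoopMeasure {V : Type*} (Q : V → V → ℝ) (κ : ℝ) : Measure (BasedLoop V) :=
  Measure.sum fun b => ENNReal.ofReal (b.weight Q κ) • Measure.dirac b

/-- The loop measure `μ_κ`: push-forward of the based loop measure to the space of loops. -/
def loopMeasure {V : Type*} (Q : V → V → ℝ) (κ : ℝ) : Measure (Loop V) :=
  (basedLoopMeasure Q κ).map BasedLoop.toLoop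

/-- `ξ` is, under `P`, a Poisson random measure with intensity `ν`. -/
structure IsPoissonRandomMeasure {Ω E : Type*} [MeasurableSpace Ω] [MeasurableSpace E]
    (P : Measure Ω) (ξ : Ω → Measure E) (ν : Measure E) : Prop where
  measurable : ∀ A, MeasurableSet A → Measurable fun ω => ξ ω A
  law_of_lt_top : ∀ A, MeasurableSet A → ν A < ∞ →
    P.map (fun ω => ξ ω A) = (poissonMeasure (ν A).toNNReal).map fun k : ℕ => (k : ℝ≥0∞)
  law_of_eq_top : ∀ A, MeasurableSet A → ν A = ∞ → ∀ᵐ ω ∂P, ξ ω A = ∞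
  indep : ∀ (n : ℕ) (A : Fin n → Set E), (∀ i, MeasurableSet (A i)) →
    Pairwise (fun i j => Disjoint (A i) (A j)) → iIndepFun (fun i ω => ξ ω (A i)) P

/-- The point measure `∑_ℓ m(ℓ) δ_ℓ` of a collection of loops in which each loop `ℓ` occurs
with multiplicity `m ℓ`. -/
def pointMeasure {V : Type*} (m : Loop V → ℕ) : Measure (Loop V) :=
  Measure.sum fun ℓ => (m ℓ : ℝ≥0∞) • Measure.dirac ℓ

/-- The random collection of loops `L` (given by multiplicities) is the Poisson loop ensemble
`𝓛_{α,κ}` of the walk with transition matrix `Q`: its point measure is a Poisson random measure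
of intensity `α μ_κ`. -/
def IsPoissonLoopEnsemble {Ω V : Type*} [MeasurableSpace Ω] (P : Measure Ω) (Q : V → V → ℝ)
    (α κ : ℝ) (L : Ω → Loop V → ℕ) : Prop :=
  IsPoissonRandomMeasure P (fun ω => pointMeasure (L ω)) (ENNReal.ofReal α • loopMeasure Q κ)

/-- The graph of open edges: the edges of `G` traversed by at least one loop of the collection. -/
def openGraph {V : Type*} (G : SimpleGraph V) (m : Loop V → ℕ) : SimpleGraph V where
  Adj x y := G.Adj x y ∧ ∃ ℓ, m ℓ ≠ 0 ∧ ℓ.Traverses s(x, y)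
  symm := ⟨fun x y h => ⟨h.1.symm, by rw [Sym2.eq_swap]; exact h.2⟩⟩
  loopless := ⟨fun x h => G.loopless.irrefl x h.1⟩

/-- The infinite open clusters: the infinite connected components of the graph of open edges. -/
def infiniteClusters {V : Type*} (G : SimpleGraph V) (m : Loop V → ℕ) : Set (Set V) :=
  {C | C.Infinite ∧ ∃ c : (openGraph G m).ConnectedComponent, C = c.supp}

end LoopSoup

end

/-! This is the Burton–Keane argument. The mass of a single loop is finite, because a loop has only
finitely many based representatives. So the multiplicities of the loops are independent Poisson
variables, and the ensemble is a product measure over the countable set of loops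
(`IsPoissonLoopEnsemble.map_eq_infinitePi`). Only masses of single loops enter, which is why every
`κ > -1` is covered.

Three properties of this measure are used. Translations preserve it. Events invariant under
translation have probability zero or one (`measure_eq_zero_or_one_of_invariant`), since finitely
many loops can be moved off themselves. It is insertion tolerant: setting the multiplicity of the
loop `a → b → a` to one opens only the edge `ab`, and this map pulls null events back to null events
(`quasiMeasurePreserving_update`).

The rest is percolation theory (`ae_not_twoInfinite`). If at least two, but not three, infinite
clusters had positive probability, then at least two would occur almost surely; yet opening a large
box merges them into one. Three infinite clusters joined by an open box give a trifurcation. By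
stationarity trifurcations of positive probability would have positive density, whereas a large cube
contains at most as many disjoint ones as it has outer boundary points (`card_branching_le`,
`card_trifurcation_le`). -/

namespace LoopSoup

/-! ### Combinatorics of abstract branching points -/

section Branching

variable {ι V : Type*} {R : ι → V → V → Prop} {E : V → V → Prop} {x : ι → V}

open Classical in
/-- In a finite family of branching points there is one such that all the others of its cluster
lie in a single branch. -/
theorem exists_extremal_branching (hR : ∀ i, Equivalence (R i)) (hE : Equivalence E)
    (hRE : ∀ i a b, R i a b → E a b)
    (h2 : ∀ i j, i ≠ j → ∀ a, E a (x i) → R i a (x j) ∨ R j a (x i))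
    (J : Finset ι) (hJ : J.Nonempty) :
    ∃ i ∈ J, ∀ j ∈ J, ∀ k ∈ J, j ≠ i → k ≠ i → E (x j) (x i) → E (x k) (x i) →
      R i (x j) (x k) := by
  set S : Finset (ι × ι) := (J ×ˢ J).filter fun p => p.1 ≠ p.2 ∧ E (x p.2) (x p.1) with hS
  rcases S.eq_empty_or_nonempty with h0 | hne
  · obtain ⟨i, hi⟩ := hJ
    refine ⟨i, hi, fun j hj k _ hji _ hEj _ => ?_⟩
    have : (i, j) ∈ S := by simp [hS, hi, hj, hji.symm, hEj]
    simp [h0] at this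
  -- Choose the branch, at `i` towards `j`, holding the most points of `J`. If some `k` lay in
  -- another branch of `i`, the branch of `k` towards `i` would contain all these points and `i` as
  -- well.
  · obtain ⟨⟨i, j⟩, hmem, hmax⟩ := S.exists_max_image
      (fun p => (J.filter fun k => k ≠ p.1 ∧ R p.1 (x k) (x p.2)).card) hne
    simp only [hS, Finset.mem_filter, Finset.mem_product] at hmem
    obtain ⟨⟨hi, hj⟩, hij, hEj⟩ := hmem
    have key : ∀ k ∈ J, k ≠ i → E (x k) (x i) → R i (x k) (x j) := by
      intro k hk hki hEk
      by_contra hcon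
      have hkS : (k, i) ∈ S := by simp [hS, hi, hk, hki, hE.symm hEk]
      have hle := hmax _ hkS
      refine absurd hle (not_le.2 (Finset.card_lt_card ?_))
      refine (Finset.ssubset_iff_of_subset ?_).2 ⟨i, ?_, ?_⟩
      · intro l hl
        simp only [Finset.mem_filter] at hl ⊢
        obtain ⟨hlJ, hli, hl⟩ := hl
        have hlk : l ≠ k := by rintro rfl; exact hcon hl
        refine ⟨hlJ, hlk, ?_⟩
        rcases h2 i k hki.symm (x l) (hE.trans (hRE _ _ _ hl) hEj) with h | h
        · exact absurd ((hR i).trans ((hR i).symm h) hl) hcon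
        · exact h
      · simp only [Finset.mem_filter]
        exact ⟨hi, hki.symm, (hR k).refl _⟩
      · simp
    exact ⟨i, hi, fun a ha b hb hai hbi hEa hEb =>
      (hR i).trans (key a ha hai hEa) ((hR i).symm (key b hb hbi hEb))⟩

open Classical in
/-- The number of branching points, each of which has three branches reaching the finite set `D`,
is at most the number of points of `D`. -/
theorem card_branching_le [Fintype ι] (hR : ∀ i, Equivalence (R i)) (hE : Equivalence E)
    (hRE : ∀ i a b, R i a b → E a b)
    (h2 : ∀ i j, i ≠ j → ∀ a, E a (x i) → R i a (x j) ∨ R j a (x i))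
    (D : Finset V) (u : ι → Fin 3 → V) (hD : ∀ i k, u i k ∈ D) (hu : ∀ i k, E (u i k) (x i))
    (hne : ∀ i k l, k ≠ l → ¬ R i (u i k) (u i l)) :
    Fintype.card ι ≤ D.card := by
  -- Each branching point labels its three branches 1, 2, 3 and everything else 0. These labellings,
  -- restricted to `D`, turn out to be linearly independent, so the dimension of `ℝ^D` bounds their
  -- number.
  let f : ι → V → ℝ := fun i a =>
    ∑ k : Fin 3, if R i a (u i k) then ((k : ℕ) : ℝ) + 1 else 0
  have f_congr : ∀ i a b, R i a b → f i a = f i b := by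
    intro i a b hab
    refine Finset.sum_congr rfl fun k _ => ?_
    have : R i a (u i k) ↔ R i b (u i k) :=
      ⟨fun h => (hR i).trans ((hR i).symm hab) h, fun h => (hR i).trans hab h⟩
    simp only [this]
  have f_val : ∀ i k, f i (u i k) = ((k : ℕ) : ℝ) + 1 := by
    intro i k
    have : ∀ l : Fin 3, R i (u i k) (u i l) ↔ l = k := fun l =>
      ⟨fun h => by by_contra hlk; exact hne i k l (Ne.symm hlk) h,
        fun h => by subst h; exact (hR i).refl _⟩
    simp only [f, this, Finset.sum_ite_eq', Finset.mem_univ, if_true]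
  have hlin : LinearIndependent ℝ (fun i (y : D) => f i y) := by
    rw [Fintype.linearIndependent_iff]
    intro c hc
    by_contra hcon
    push Not at hcon
    obtain ⟨i0, hi0⟩ := hcon
    obtain ⟨i, hi, hleaf⟩ := exists_extremal_branching hR hE hRE h2
      (Finset.univ.filter fun i => c i ≠ 0) ⟨i0, by simpa using hi0⟩
    simp only [Finset.mem_filter, Finset.mem_univ, true_and] at hi hleaf
    have huniq : ∀ k l, k ≠ l → (∃ j, c j ≠ 0 ∧ j ≠ i ∧ R i (u i k) (x j)) →
        (∃ j, c j ≠ 0 ∧ j ≠ i ∧ R i (u i l) (x j)) → False := by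
      rintro k l hkl ⟨j, hj, hji, hkj⟩ ⟨j', hj', hji', hlj⟩
      refine hne i k l hkl ((hR i).trans hkj ((hR i).trans (hleaf j hj j' hj' hji hji' ?_ ?_)
        ((hR i).symm hlj)))
      · exact hE.trans (hE.symm (hRE _ _ _ hkj)) (hu i k)
      · exact hE.trans (hE.symm (hRE _ _ _ hlj)) (hu i l)
    -- For the extremal `i` at most one of the three branches contains other points of the support
    -- of `c`. Any other `f j` with `c j ≠ 0` cannot distinguish the two free branches, so comparing
    -- the relation on them isolates `c i`.
    obtain ⟨k, l, hkl, hk, hl⟩ : ∃ k l : Fin 3, k ≠ l ∧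
        (¬ ∃ j, c j ≠ 0 ∧ j ≠ i ∧ R i (u i k) (x j)) ∧
        (¬ ∃ j, c j ≠ 0 ∧ j ≠ i ∧ R i (u i l) (x j)) := by
      by_cases h0 : ∃ j, c j ≠ 0 ∧ j ≠ i ∧ R i (u i 0) (x j)
      · exact ⟨1, 2, by decide, fun h => huniq 0 1 (by decide) h0 h,
          fun h => huniq 0 2 (by decide) h0 h⟩
      · by_cases h1 : ∃ j, c j ≠ 0 ∧ j ≠ i ∧ R i (u i 1) (x j)
        · exact ⟨0, 2, by decide, h0, fun h => huniq 1 2 (by decide) h1 h⟩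
        · exact ⟨0, 1, by decide, h0, h1⟩
    have heq : ∀ j, j ≠ i → c j * f j (u i k) = c j * f j (u i l) := by
      intro j hji
      by_cases hj : c j = 0
      · simp [hj]
      congr 1
      have side : ∀ m, (¬ ∃ j, c j ≠ 0 ∧ j ≠ i ∧ R i (u i m) (x j)) → R j (u i m) (x i) :=
        fun m hm => (h2 i j hji.symm _ (hu i m)).resolve_left fun h => hm ⟨j, hj, hji, h⟩
      exact f_congr j _ _ ((hR j).trans (side k hk) ((hR j).symm (side l hl)))
    have e1 := congrFun hc ⟨u i k, hD i k⟩
    have e2 := congrFun hc ⟨u i l, hD i l⟩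
    simp only [Finset.sum_apply, Pi.smul_apply, smul_eq_mul, Pi.zero_apply] at e1 e2
    rw [← Finset.add_sum_erase _ _ (Finset.mem_univ i)] at e1 e2
    rw [Finset.sum_congr rfl fun j hj => heq j (Finset.ne_of_mem_erase hj)] at e1
    rw [f_val] at e1 e2
    have : c i * ((k : ℕ) - (l : ℕ) : ℝ) = 0 := by linarith
    rcases mul_eq_zero.1 this with h | h
    · exact hi h
    · exact hkl (Fin.ext (by exact_mod_cast sub_eq_zero.1 h))
  simpa using hlin.fintype_card_le_finrank

end Branching

/-! ### Removing vertex sets from a graph -/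

section Graph

variable {V : Type*}

/-- The graph `H` without the edges that touch the set `S`. -/
def off (H : SimpleGraph V) (S : Set V) : SimpleGraph V where
  Adj x y := H.Adj x y ∧ x ∉ S ∧ y ∉ S
  symm := ⟨fun _ _ h => ⟨h.1.symm, h.2.2, h.2.1⟩⟩
  loopless := ⟨fun x h => H.loopless.irrefl x h.1⟩

theorem off_le (H : SimpleGraph V) (S : Set V) : off H S ≤ H := fun _ _ h => h.1

/-- The vertex `a` lies in an infinite connected component of `H`. -/
def InInfinite (H : SimpleGraph V) (a : V) : Prop := {v | H.Reachable a v}.Infinite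

/-- There are at least two infinite clusters. -/
def TwoInfinite (H : SimpleGraph V) : Prop :=
  ∃ a b, InInfinite H a ∧ InInfinite H b ∧ ¬ H.Reachable a b

/-- There are at least three infinite clusters. -/
def ThreeInfinite (H : SimpleGraph V) : Prop :=
  ∃ a : Fin 3 → V, (∀ i, InInfinite H (a i)) ∧ ∀ i j, i ≠ j → ¬ H.Reachable (a i) (a j)

/-- Induction along a walk towards its endpoint. -/
theorem Reachable.head_induction {H : SimpleGraph V} {b : V} {p : V → Prop} (hb : p b)
    (hstep : ∀ v w, H.Adj v w → H.Reachable w b → p w → p v) {a : V} (h : H.Reachable a b) :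
    p a := by
  obtain ⟨w⟩ := h
  induction w with
  | nil => exact hb
  | cons hadj q ih => exact hstep _ _ hadj ⟨q⟩ (ih hb hstep)

/-- Walking back from `x`, either alternative survives a step that avoids both sets, and a visit to
`S` or `T` settles the matter by hypothesis. For disjoint boxes this is the tree-like compatibility
`h2` of `card_branching_le`. -/
theorem off_reachable_or {H : SimpleGraph V} {S T : Set V} (hST : Disjoint S T) {x y : V}
    (hS : ∀ u ∈ S, (off H T).Reachable u x)
    (hT : ∀ u ∈ T, (off H S).Reachable u y) {a : V} (ha : H.Reachable a x) :
    (off H S).Reachable a y ∨ (off H T).Reachable a x := by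
  refine Reachable.head_induction (p := fun a => (off H S).Reachable a y ∨
    (off H T).Reachable a x) (Or.inr (SimpleGraph.Reachable.refl x)) ?_ ha
  intro v w hvw _ hw
  by_cases hvS : v ∈ S
  · exact Or.inr (hS v hvS)
  by_cases hvT : v ∈ T
  · exact Or.inl (hT v hvT)
  have stepS : w ∉ S → (off H S).Reachable w y → (off H S).Reachable v y := fun h1 h2 =>
    (SimpleGraph.Adj.reachable (G := off H S) ⟨hvw, hvS, h1⟩).trans h2
  have stepT : w ∉ T → (off H T).Reachable w x → (off H T).Reachable v x := fun h1 h2 =>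
    (SimpleGraph.Adj.reachable (G := off H T) ⟨hvw, hvT, h1⟩).trans h2
  by_cases hwS : w ∈ S
  · exact Or.inr (stepT (Set.disjoint_left.1 hST hwS) (hS w hwS))
  by_cases hwT : w ∈ T
  · exact Or.inl (stepS hwS (hT w hwT))
  exact hw.imp (stepS hwS) (stepT hwT)

end Graph

/-! ### Boxes and trifurcations in the lattice -/

section Lattice

variable {d : ℕ}

/-- The box of radius `k` around `x`. -/
noncomputable def box (x : Fin d → ℤ) (k : ℕ) : Finset (Fin d → ℤ) :=
  Finset.Icc (fun i => x i - k) (fun i => x i + k)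

theorem mem_box {x y : Fin d → ℤ} {k : ℕ} : y ∈ box x k ↔ ∀ i, x i - k ≤ y i ∧ y i ≤ x i + k := by
  simp only [box, Finset.mem_Icc, Pi.le_def, forall_and]

theorem self_mem_box (x : Fin d → ℤ) (k : ℕ) : x ∈ box x k := by
  rw [mem_box]; intro i; omega

theorem abs_sub_le_one_of_adj {x y : Fin d → ℤ} (h : (lattice d).Adj x y) (i : Fin d) :
    |x i - y i| ≤ 1 := by
  have h' : ∑ i, |x i - y i| = 1 := h
  rw [← h']
  exact Finset.single_le_sum (f := fun i => |x i - y i|) (fun _ _ => abs_nonneg _)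
    (Finset.mem_univ i)

theorem mem_box_succ_of_adj {x y z : Fin d → ℤ} {k : ℕ} (hy : y ∈ box x k)
    (h : (lattice d).Adj y z) : z ∈ box x (k + 1) := by
  rw [mem_box] at hy ⊢
  intro i
  have h1 := abs_le.1 (abs_sub_le_one_of_adj h i)
  have h2 := hy i
  push_cast
  constructor <;> linarith [h1.1, h1.2, h2.1, h2.2]

theorem lattice_adj_update {x : Fin d → ℤ} {i : Fin d} {c : ℤ} (hc : |x i - c| = 1) :
    (lattice d).Adj x (Function.update x i c) := by
  change ∑ j, |x j - Function.update x i c j| = 1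
  rw [Finset.sum_eq_single i]
  · simpa using hc
  · intro j _ hj
    simp [hj]
  · simp

/-- A graph that contains all the lattice edges of a box connects the points of the box. -/
theorem box_connected {H : SimpleGraph (Fin d → ℤ)} {x : Fin d → ℤ} {k : ℕ}
    (hH : ∀ a ∈ box x k, ∀ b ∈ box x k, (lattice d).Adj a b → H.Adj a b) {T : Set (Fin d → ℤ)}
    (hT : Disjoint (box x k : Set (Fin d → ℤ)) T) :
    ∀ u ∈ box x k, (off H T).Reachable u x := by
  -- Induction on the `ℓ¹`-distance to the centre: moving one coordinate towards that of `x` does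
  -- not leave the box.
  suffices h : ∀ n : ℕ, ∀ u ∈ box x k, ∑ i, (u i - x i).natAbs = n → (off H T).Reachable u x from
    fun u hu => h _ u hu rfl
  intro n
  induction n with
  | zero =>
    intro u _ h0
    have : u = x := by
      funext i
      have := (Finset.sum_eq_zero_iff.1 h0) i (Finset.mem_univ i)
      omega
    rw [this]
  | succ n ih =>
    intro u hu hn
    have : ∃ i, u i ≠ x i := by
      by_contra hcon
      push Not at hcon
      simp [hcon] at hn
    obtain ⟨i, hi⟩ := this
    obtain ⟨c, hc, hcx, hlo, hhi⟩ : ∃ c : ℤ, |u i - c| = 1 ∧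
        (u i - x i).natAbs = (c - x i).natAbs + 1 ∧ min (u i) (x i) ≤ c ∧ c ≤ max (u i) (x i) := by
      rcases lt_or_gt_of_ne hi with h | h
      · exact ⟨u i + 1, by simp, by omega, by omega, by omega⟩
      · exact ⟨u i - 1, by simp, by omega, by omega, by omega⟩
    set v := Function.update u i c with hv
    have hvbox : v ∈ box x k := by
      rw [mem_box] at hu ⊢
      intro j
      by_cases hj : j = i
      · subst hj
        have := hu j
        simp only [hv, Function.update_self]
        omega
      · simpa [hv, hj] using hu j
    have huv : (lattice d).Adj u v := lattice_adj_update hc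
    have hsum : ∑ j, (v j - x j).natAbs = n := by
      rw [← Finset.add_sum_erase _ _ (Finset.mem_univ i)] at hn ⊢
      have : ∑ j ∈ Finset.univ.erase i, (v j - x j).natAbs =
          ∑ j ∈ Finset.univ.erase i, (u j - x j).natAbs :=
        Finset.sum_congr rfl fun j hj => by simp [hv, Finset.ne_of_mem_erase hj]
      rw [this]
      simp only [hv, Function.update_self]
      omega
    have hadj : (off H T).Adj u v :=
      ⟨hH u hu v hvbox huv, Set.disjoint_left.1 hT hu, Set.disjoint_left.1 hT hvbox⟩
    exact hadj.reachable.trans (ih v hvbox hsum)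

theorem box_connected' {H : SimpleGraph (Fin d → ℤ)} {x : Fin d → ℤ} {k : ℕ}
    (hH : ∀ a ∈ box x k, ∀ b ∈ box x k, (lattice d).Adj a b → H.Adj a b) :
    ∀ u ∈ box x k, H.Reachable u x := fun u hu =>
  (box_connected hH (Set.disjoint_empty _) u hu).mono (off_le H _)

/-- An infinite cluster that meets a box has an infinite branch outside the box which starts next
to the box. -/
theorem exists_infinite_branch {H : SimpleGraph (Fin d → ℤ)} (hH : H ≤ lattice d)
    {x a : Fin d → ℤ} {k : ℕ} (ha : a ∈ box x k) (hinf : InInfinite H a) :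
    ∃ u ∈ box x (k + 1), u ∉ box x k ∧ H.Reachable u a ∧ InInfinite (off H (box x k)) u := by
  by_contra hcon
  push Not at hcon
  -- If all branches starting next to the box were finite, the cluster would be covered by the box
  -- and finitely many finite sets.
  refine hinf (Set.Finite.subset (s := (box x k : Set (Fin d → ℤ)) ∪
    ⋃ u ∈ {u | u ∈ box x (k + 1) ∧ u ∉ box x k ∧ H.Reachable u a},
      {v | (off H (box x k)).Reachable u v}) ?_ ?_)
  · refine (Finset.finite_toSet _).union (Set.Finite.biUnion ?_ ?_)
    · exact (box x (k + 1)).finite_toSet.subset fun u hu => hu.1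
    · exact fun u hu => Set.not_infinite.1 (hcon u hu.1 hu.2.1 hu.2.2)
  · intro v hv
    refine Reachable.head_induction (p := fun v => v ∈ (box x k : Set (Fin d → ℤ)) ∪
      ⋃ u ∈ {u | u ∈ box x (k + 1) ∧ u ∉ box x k ∧ H.Reachable u a},
      {v | (off H (box x k)).Reachable u v}) (Or.inl ha) ?_ hv.symm
    intro v w hvw hwa hw
    by_cases hvb : v ∈ box x k
    · exact Or.inl hvb
    refine Or.inr ?_
    simp only [Set.mem_iUnion, Set.mem_ofPred_eq, exists_prop]
    by_cases hwb : w ∈ box x k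
    · exact ⟨v, ⟨mem_box_succ_of_adj hwb (hH hvw.symm), hvb, hvw.reachable.trans hwa⟩,
        SimpleGraph.Reachable.refl _⟩
    · rcases hw with hw | hw
      · exact absurd hw hwb
      simp only [Set.mem_iUnion, Set.mem_ofPred_eq, exists_prop] at hw
      obtain ⟨u, hu, huw⟩ := hw
      exact ⟨u, hu, huw.trans (SimpleGraph.Adj.reachable (G := off H (box x k))
        ⟨hvw.symm, hwb, hvb⟩)⟩

/-- The box of radius `k` around `x` is fully open, and removing it leaves at least three infinite
components next to it in its cluster. -/
def IsTrifurcation (H : SimpleGraph (Fin d → ℤ)) (k : ℕ) (x : Fin d → ℤ) : Prop :=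
  (∀ a ∈ box x k, ∀ b ∈ box x k, (lattice d).Adj a b → H.Adj a b) ∧
  ∃ u : Fin 3 → Fin d → ℤ, (∀ i, u i ∈ box x (k + 1) ∧ H.Reachable (u i) x ∧
    InInfinite (off H (box x k)) (u i)) ∧
    ∀ i j, i ≠ j → ¬ (off H (box x k)).Reachable (u i) (u j)

/-- Disjoint trifurcation boxes inside a finite region are at most as many as the points of its
outer boundary. -/
theorem card_trifurcation_le {H : SimpleGraph (Fin d → ℤ)} (hH : H ≤ lattice d) {k : ℕ}
    {Z S D : Finset (Fin d → ℤ)} (hZ : ∀ x ∈ Z, IsTrifurcation H k x)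
    (hdisj : ∀ x ∈ Z, ∀ y ∈ Z, x ≠ y →
      Disjoint (box x k : Set (Fin d → ℤ)) (box y k : Set (Fin d → ℤ)))
    (hS : ∀ x ∈ Z, box x (k + 1) ⊆ S)
    (hD : ∀ a ∈ S, ∀ b, b ∉ S → (lattice d).Adj a b → b ∈ D) : Z.card ≤ D.card := by
  -- An infinite branch must leave the finite region `S`. The walk that leaves it enters `D` without
  -- touching the removed box, so the exit point is still in the branch.
  have exit : ∀ x ∈ Z, ∀ u, u ∈ box x (k + 1) → InInfinite (off H (box x k)) u →
      ∃ w ∈ D, (off H (box x k)).Reachable u w := by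
    intro x hx u hu hinf
    obtain ⟨v, hv, hvS⟩ := hinf.exists_notMem_finset S
    obtain ⟨p⟩ : (off H (box x k)).Reachable u v := hv
    obtain ⟨e, he, he1, he2⟩ := p.exists_boundary_dart (S : Set (Fin d → ℤ)) (hS x hx hu) hvS
    exact ⟨e.snd, hD _ he1 _ he2 (hH e.adj.1),
      ⟨p.takeUntil _ (p.dart_snd_mem_support_of_mem_darts he)⟩⟩
  choose! u hu hne using fun x hx => (hZ x hx).2
  choose! w hwD huw using fun x hx i => exit x hx (u x i) (hu x hx i).1 (hu x hx i).2.2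
  have := card_branching_le (ι := Z) (R := fun x => (off H (box x.1 k)).Reachable)
    (E := H.Reachable) (x := fun x => x.1) (fun x => (off H (box x.1 k)).reachable_is_equivalence)
    H.reachable_is_equivalence (fun x a b h => h.mono (off_le H _)) ?_ D (fun x => w x.1)
    (fun x i => hwD _ x.2 i) ?_ ?_
  · simpa using this
  · intro x y hxy a ha
    have hd := hdisj x.1 x.2 y.1 y.2 (fun h => hxy (Subtype.ext h))
    exact off_reachable_or hd (box_connected (hZ _ x.2).1 hd)
      (box_connected (hZ _ y.2).1 hd.symm) ha
  · intro x i
    exact ((huw _ x.2 i).mono (off_le H _)).symm.trans (hu _ x.2 i).2.1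
  · intro x i j hij h
    exact hne _ x.2 i j hij ((huw _ x.2 i).trans (h.trans (huw _ x.2 j).symm))

/-- The lattice edges inside a box. -/
def boxGraph (x : Fin d → ℤ) (k : ℕ) : SimpleGraph (Fin d → ℤ) where
  Adj a b := (lattice d).Adj a b ∧ a ∈ box x k ∧ b ∈ box x k
  symm := ⟨fun _ _ h => ⟨h.1.symm, h.2.2, h.2.1⟩⟩
  loopless := ⟨fun x h => (lattice d).loopless.irrefl x h.1⟩

/-- The added edges have their ends in the box, so opening the box does not change the branches
outside it. -/
theorem off_sup_boxGraph (H : SimpleGraph (Fin d → ℤ)) (x : Fin d → ℤ) (k : ℕ) :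
    off (H ⊔ boxGraph x k) (box x k) = off H (box x k) := by
  ext a b
  simp only [off, SimpleGraph.sup_adj, boxGraph, Finset.mem_coe]
  tauto

theorem reachable_sup_boxGraph (H : SimpleGraph (Fin d → ℤ)) (x : Fin d → ℤ) (k : ℕ)
    {a : Fin d → ℤ} (ha : a ∈ box x k) : (H ⊔ boxGraph x k).Reachable a x :=
  box_connected' (fun _ ha _ hb h => Or.inr ⟨h, ha, hb⟩) a ha

/-- Opening a box that meets three infinite clusters creates a trifurcation. -/
theorem isTrifurcation_sup_boxGraph {H : SimpleGraph (Fin d → ℤ)} (hH : H ≤ lattice d)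
    {x : Fin d → ℤ} {k : ℕ} {a : Fin 3 → Fin d → ℤ} (ha : ∀ i, a i ∈ box x k)
    (hinf : ∀ i, InInfinite H (a i)) (hne : ∀ i j, i ≠ j → ¬ H.Reachable (a i) (a j)) :
    IsTrifurcation (H ⊔ boxGraph x k) k x := by
  refine ⟨fun a ha b hb h => Or.inr ⟨h, ha, hb⟩, ?_⟩
  rw [off_sup_boxGraph]
  choose u hu _ hua huinf using fun i => exists_infinite_branch hH (ha i) (hinf i)
  refine ⟨u, fun i => ⟨hu i, ?_, huinf i⟩, fun i j hij h => ?_⟩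
  · exact ((hua i).mono le_sup_left).trans (reachable_sup_boxGraph H x k (ha i))
  · exact hne i j hij ((hua i).symm.trans ((h.mono (off_le H _)).trans (hua j)))

/-- Opening a box that meets two infinite clusters, when there is no third one, leaves at most one
infinite cluster. -/
theorem not_twoInfinite_sup_boxGraph {H : SimpleGraph (Fin d → ℤ)} (h3 : ¬ ThreeInfinite H)
    {x a b : Fin d → ℤ} {k : ℕ} (ha : a ∈ box x k) (hb : b ∈ box x k)
    (hai : InInfinite H a) (hbi : InInfinite H b) (hab : ¬ H.Reachable a b) :
    ¬ TwoInfinite (H ⊔ boxGraph x k) := by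
  have key : ∀ v, InInfinite (H ⊔ boxGraph x k) v → (H ⊔ boxGraph x k).Reachable v x := by
    intro v hv
    by_cases hmeet : ∃ w ∈ box x k, H.Reachable v w
    · obtain ⟨w, hw, hvw⟩ := hmeet
      exact (hvw.mono le_sup_left).trans (reachable_sup_boxGraph H x k hw)
    push Not at hmeet
    -- A cluster that misses the box is unaffected by opening it; if infinite, it would be a third
    -- infinite cluster of `H` besides those of `a` and `b`.
    have hsub : ∀ w, (H ⊔ boxGraph x k).Reachable w v → H.Reachable w v := by
      intro w hw
      refine Reachable.head_induction (p := fun w => H.Reachable w v)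
        (SimpleGraph.Reachable.refl _) ?_ hw
      intro p q hpq _ hq
      rcases hpq with h | h
      · exact h.reachable.trans hq
      · exact absurd hq.symm (hmeet q h.2.2)
    have hvi : InInfinite H v := hv.mono fun w hw => (hsub w hw.symm).symm
    refine absurd ⟨![a, b, v], ?_, ?_⟩ h3
    · intro i; fin_cases i <;> simp [hai, hbi, hvi]
    · have h1 : ¬ H.Reachable a v := fun h => hmeet a ha h.symm
      have h2 : ¬ H.Reachable b v := fun h => hmeet b hb h.symm
      have h1' : ¬ H.Reachable v a := hmeet a ha
      have h2' : ¬ H.Reachable v b := hmeet b hb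
      have hba : ¬ H.Reachable b a := fun h => hab h.symm
      intro i j hij
      fin_cases i <;> fin_cases j <;> simp_all
  rintro ⟨p, q, hp, hq, hpq⟩
  exact hpq ((key p hp).trans (key q hq).symm)

end Lattice

/-! ### Invariance under graph isomorphisms -/

section Iso

variable {V W : Type*} {H : SimpleGraph V} {H' : SimpleGraph W}

theorem InInfinite.map_iso (e : H ≃g H') {a : V} (h : InInfinite H a) : InInfinite H' (e a) := by
  refine (h.image (e.injective.injOn)).mono ?_
  rintro _ ⟨v, hv, rfl⟩
  exact e.reachable_iff.2 hv

theorem TwoInfinite.map_iso (e : H ≃g H') (h : TwoInfinite H) : TwoInfinite H' := by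
  obtain ⟨a, b, ha, hb, hab⟩ := h
  exact ⟨e a, e b, ha.map_iso e, hb.map_iso e, fun h => hab (e.reachable_iff.1 h)⟩

/-- An isomorphism restricts to the graphs without the edges touching corresponding sets. -/
def offIso (e : H ≃g H') {S : Set V} {S' : Set W} (hS : ∀ v, e v ∈ S' ↔ v ∈ S) :
    off H S ≃g off H' S' where
  toEquiv := e.toEquiv
  map_rel_iff' := by
    intro a b
    exact and_congr e.map_rel_iff' (and_congr (not_congr (hS a)) (not_congr (hS b)))

end Iso

/-! ### Measurability of connectivity events -/

section Measurability

variable {X V : Type*} [MeasurableSpace X] {g : X → SimpleGraph V}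

theorem measurable_off (hg : ∀ a b, Measurable fun m => (g m).Adj a b) (S : Set V) (a b : V) :
    Measurable fun m => (off (g m) S).Adj a b :=
  (hg a b).and (measurable_const (a := a ∉ S ∧ b ∉ S))

variable [Countable V]

theorem measurable_reachable (hg : ∀ a b, Measurable fun m => (g m).Adj a b) (a b : V) :
    Measurable fun m => (g m).Reachable a b := by
  have hlen : ∀ n a, Measurable fun m => ∃ p : (g m).Walk a b, p.length = n := by
    intro n
    induction n with
    | zero =>
      intro a
      have : (fun m => ∃ p : (g m).Walk a b, p.length = 0) = fun _ => a = b := by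
        funext m
        exact propext SimpleGraph.Walk.exists_length_eq_zero_iff
      rw [this]
      exact measurable_const
    | succ n ih =>
      intro a
      have : (fun m => ∃ p : (g m).Walk a b, p.length = n + 1) =
          fun m => ∃ c, (g m).Adj a c ∧ ∃ p : (g m).Walk c b, p.length = n := by
        funext m
        refine propext ⟨?_, ?_⟩
        · rintro ⟨p, hp⟩
          cases p with
          | nil => simp at hp
          | cons h q => exact ⟨_, h, q, by simpa using hp⟩
        · rintro ⟨c, h, q, hq⟩
          exact ⟨.cons h q, by simp [hq]⟩
      rw [this]
      exact Measurable.exists fun c => (hg a c).and (ih c)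
  have : (fun m => (g m).Reachable a b) = fun m => ∃ n, ∃ p : (g m).Walk a b, p.length = n := by
    funext m
    exact propext ⟨fun ⟨p⟩ => ⟨_, p, rfl⟩, fun ⟨_, p, _⟩ => ⟨p⟩⟩
  rw [this]
  exact Measurable.exists fun n => hlen n a

/-- A cluster is infinite when it escapes every finite set of vertices, and there are only countably
many of these. -/
theorem measurable_inInfinite (hg : ∀ a b, Measurable fun m => (g m).Adj a b) (a : V) :
    Measurable fun m => InInfinite (g m) a := by
  have : (fun m => InInfinite (g m) a) =
      fun m => ∀ F : Finset V, ∃ b, b ∉ F ∧ (g m).Reachable a b := by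
    funext m
    refine propext ⟨fun h F => ?_, fun h hfin => ?_⟩
    · obtain ⟨b, hb, hF⟩ := h.exists_notMem_finset F
      exact ⟨b, hF, hb⟩
    · obtain ⟨b, hb, hr⟩ := h hfin.toFinset
      exact hb (hfin.mem_toFinset.2 hr)
  rw [this]
  exact Measurable.forall fun F => Measurable.exists fun b =>
    measurable_const.and (measurable_reachable hg a b)

theorem measurable_twoInfinite (hg : ∀ a b, Measurable fun m => (g m).Adj a b) :
    Measurable fun m => TwoInfinite (g m) :=
  Measurable.exists fun a => Measurable.exists fun b => (measurable_inInfinite hg a).and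
    ((measurable_inInfinite hg b).and (measurable_reachable hg a b).not)

theorem measurable_isTrifurcation {d : ℕ} {g : X → SimpleGraph (Fin d → ℤ)}
    (hg : ∀ a b, Measurable fun m => (g m).Adj a b) (k : ℕ) (x : Fin d → ℤ) :
    Measurable fun m => IsTrifurcation (g m) k x := by
  refine Measurable.and ?_ ?_
  · exact Measurable.forall fun a => Measurable.forall fun _ => Measurable.forall fun b =>
      Measurable.forall fun _ => Measurable.forall fun _ => hg a b
  · refine Measurable.exists fun u => Measurable.and ?_ ?_
    · exact Measurable.forall fun i => measurable_const.and
        ((measurable_reachable hg _ _).and (measurable_inInfinite (measurable_off hg _) _))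
    · exact Measurable.forall fun i => Measurable.forall fun j => Measurable.forall fun _ =>
        (measurable_reachable (measurable_off hg _) _ _).not

end Measurability

/-! ### Trifurcations in a large cube: volume against boundary -/

section Counting

variable {d : ℕ}

/-- Centres of disjoint boxes of radius `k`, arranged in a cube of `n ^ d` cells of side
`2 * k + 3`. -/
def cellCentre (k : ℕ) {n : ℕ} (z : Fin d → Fin n) : Fin d → ℤ :=
  -- Boxes of radius `k + 1` have side `2 * k + 3`, so around these centres they tile the cube with
  -- corner at the origin.
  fun i => (2 * k + 3) * ((z i : ℕ) : ℤ) + (k + 1)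

theorem disjoint_box_cellCentre (k : ℕ) {n : ℕ} {z z' : Fin d → Fin n} (h : z ≠ z') :
    Disjoint (box (cellCentre k z) k : Set (Fin d → ℤ)) (box (cellCentre k z') k) := by
  obtain ⟨i, hi⟩ := Function.ne_iff.1 h
  rw [Set.disjoint_left]
  intro y hy hy'
  have h1 := mem_box.1 hy i
  have h2 := mem_box.1 hy' i
  simp only [cellCentre] at h1 h2
  rcases lt_or_gt_of_ne (fun h => hi (Fin.ext h) : (z i : ℕ) ≠ z' i) with h | h
  · have : ((z i : ℕ) : ℤ) + 1 ≤ (z' i : ℕ) := by exact_mod_cast h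
    nlinarith
  · have : ((z' i : ℕ) : ℤ) + 1 ≤ (z i : ℕ) := by exact_mod_cast h
    nlinarith

/-- The outer boundary of the cube of side `(2 * k + 3) * n` lies in the layer of thickness one
around it, whose size is the right-hand side. -/
theorem card_filter_trifurcation_le {H : SimpleGraph (Fin d → ℤ)} (hH : H ≤ lattice d) (k n : ℕ)
    [DecidablePred fun z : Fin d → Fin n => IsTrifurcation H k (cellCentre k z)] :
    (Finset.univ.filter fun z : Fin d → Fin n => IsTrifurcation H k (cellCentre k z)).card ≤
      ((2 * k + 3) * n + 2) ^ d - ((2 * k + 3) * n) ^ d := by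
  classical
  set N : ℕ := (2 * k + 3) * n with hN
  have hNz : (2 * (k : ℤ) + 3) * n = N := by rw [hN]; push_cast; ring
  set S : Finset (Fin d → ℤ) := Finset.Icc (fun _ => 0) (fun _ => (N : ℤ) - 1)
  set S' : Finset (Fin d → ℤ) := Finset.Icc (fun _ => -1) (fun _ => (N : ℤ))
  have hSmem : ∀ y, y ∈ S ↔ ∀ i, 0 ≤ y i ∧ y i ≤ N - 1 := fun y => by
    simp only [S, Finset.mem_Icc, Pi.le_def, forall_and]
  have hSmem' : ∀ y, y ∈ S' ↔ ∀ i, -1 ≤ y i ∧ y i ≤ N := fun y => by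
    simp only [S', Finset.mem_Icc, Pi.le_def, forall_and]
  have hinj : Function.Injective (cellCentre k : (Fin d → Fin n) → Fin d → ℤ) := by
    intro z z' h
    by_contra hne
    exact Set.disjoint_left.1 (disjoint_box_cellCentre k hne) (self_mem_box _ k)
      (h ▸ self_mem_box _ k)
  have hcard := card_trifurcation_le hH (k := k) (S := S) (D := S' \ S)
    (Z := (Finset.univ.filter fun z : Fin d → Fin n =>
      IsTrifurcation H k (cellCentre k z)).image (cellCentre k)) ?_ ?_ ?_ ?_
  · rw [Finset.card_image_of_injective _ hinj, Finset.card_sdiff_of_subset] at hcard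
    · have hN2 : ((N : ℤ) + 1 + 1).toNat = N + 2 := by omega
      simpa [S, S', Pi.card_Icc, hN2] using hcard
    · intro y hy
      rw [hSmem] at hy
      rw [hSmem']
      intro i
      have := hy i
      omega
  · intro x hx
    obtain ⟨z, hz, rfl⟩ := Finset.mem_image.1 hx
    exact (Finset.mem_filter.1 hz).2
  · intro x hx y hy hxy
    obtain ⟨z, _, rfl⟩ := Finset.mem_image.1 hx
    obtain ⟨z', _, rfl⟩ := Finset.mem_image.1 hy
    exact disjoint_box_cellCentre k fun h => hxy (by rw [h])
  · intro x hx y hy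
    obtain ⟨z, _, rfl⟩ := Finset.mem_image.1 hx
    rw [mem_box] at hy
    rw [hSmem]
    intro i
    have h1 := hy i
    simp only [cellCentre] at h1
    push_cast at h1
    have h2 : ((z i : ℕ) : ℤ) + 1 ≤ n := by exact_mod_cast (z i).2
    have h3 : (0 : ℤ) ≤ ((z i : ℕ) : ℤ) := by positivity
    constructor <;> nlinarith
  · intro a ha b hb hab
    rw [Finset.mem_sdiff, hSmem']
    refine ⟨fun i => ?_, hb⟩
    have h1 := abs_le.1 (abs_sub_le_one_of_adj hab i)
    have h2 := (hSmem a).1 ha i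
    constructor <;> linarith [h1.1, h1.2, h2.1, h2.2]

/-- A density `p` with `p * n ^ d` bounded by the size of the boundary of a cube of side `K * n`
for all `n` is not positive. -/
theorem density_nonpos_of_le_boundary {p : ℝ} {K : ℕ}
    (h : ∀ n : ℕ, (n : ℝ) ^ d * p ≤ (K * n + 2 : ℝ) ^ d - (K * n : ℝ) ^ d) : p ≤ 0 := by
  -- This is the boundary bound divided by `n ^ d`.
  have hlim : Filter.Tendsto (fun n : ℕ => ((K : ℝ) + 2 / (n : ℝ)) ^ d - (K : ℝ) ^ d)
      Filter.atTop (nhds 0) := by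
    have h1 : Filter.Tendsto (fun n : ℕ => (2 : ℝ) / (n : ℝ)) Filter.atTop (nhds 0) :=
      tendsto_const_div_atTop_nhds_zero_nat 2
    have h2 := ((h1.const_add (K : ℝ)).pow d).sub_const ((K : ℝ) ^ d)
    simpa using h2
  refine ge_of_tendsto hlim (Filter.eventually_atTop.2 ⟨1, fun n hn => ?_⟩)
  have hn' : (0 : ℝ) < n := by exact_mod_cast hn
  have e1 : (K * n + 2 : ℝ) ^ d = (n : ℝ) ^ d * ((K : ℝ) + 2 / n) ^ d := by
    rw [← mul_pow]; congr 1; field_simp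
  have e2 : (K * n : ℝ) ^ d = (n : ℝ) ^ d * (K : ℝ) ^ d := by rw [mul_comm, mul_pow]
  have := h n
  rw [e1, e2, ← mul_sub] at this
  exact le_of_mul_le_mul_left this (by positivity)

end Counting

/-! ### The Burton–Keane theorem -/

section Percolation

variable {X : Type*} {d : ℕ}
  {g : X → SimpleGraph (Fin d → ℤ)} {S : (Fin d → ℤ) → X → X}

/-- The shift by `z` as an isomorphism of configurations. -/
def shiftIso (hcov : ∀ z m a b, (g (S z m)).Adj a b ↔ (g m).Adj (a + z) (b + z)) (z : Fin d → ℤ)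
    (m : X) : g (S z m) ≃g g m where
  toEquiv := Equiv.addRight z
  map_rel_iff' := by
    intro a b
    exact (hcov z m a b).symm

theorem IsTrifurcation.of_shift
    (hcov : ∀ z m a b, (g (S z m)).Adj a b ↔ (g m).Adj (a + z) (b + z)) {k : ℕ} {z : Fin d → ℤ}
    {m : X} (h : IsTrifurcation (g (S z m)) k 0) : IsTrifurcation (g m) k z := by
  have hbox : ∀ k v, v + z ∈ box z k ↔ v ∈ box 0 k := by
    intro k v
    rw [mem_box, mem_box]
    refine forall_congr' fun i => ?_
    simp only [Pi.add_apply, Pi.zero_apply]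
    omega
  obtain ⟨hopen, u, hu, hne⟩ := h
  have hbox' : ∀ v, shiftIso hcov z m v ∈ (box z k : Set (Fin d → ℤ)) ↔
      v ∈ (box (0 : Fin d → ℤ) k : Set (Fin d → ℤ)) := hbox k
  let e : off (g (S z m)) (box (0 : Fin d → ℤ) k : Set (Fin d → ℤ)) ≃g off (g m) (box z k : Set (Fin d → ℤ)) :=
    offIso (shiftIso hcov z m) hbox'
  refine ⟨fun a ha b hb hab => ?_, fun i => u i + z, fun i => ⟨?_, ?_, ?_⟩, fun i j hij h => ?_⟩
  · have := (hcov z m (a - z) (b - z)).1 (hopen _ ((hbox k _).1 (by simpa using ha)) _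
      ((hbox k _).1 (by simpa using hb)) ?_)
    · simpa using this
    · have hab' : ∑ i, |a i - b i| = 1 := hab
      change ∑ i, |(a - z) i - (b - z) i| = 1
      simpa using hab'
  · exact (hbox _ _).2 (hu i).1
  · have : (g m).Reachable (u i + z) (0 + z) := (shiftIso hcov z m).reachable_iff.2 (hu i).2.1
    rwa [zero_add] at this
  · exact (hu i).2.2.map_iso e
  · exact hne i j hij (e.reachable_iff.1 h)

variable [MeasurableSpace X] {μ : Measure X}

/-- By stationarity the expected number of trifurcations among the `n ^ d` cells is at least `n ^ d`
times the probability at the origin, while the deterministic count is of boundary order. -/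
theorem ae_not_isTrifurcation [IsProbabilityMeasure μ] (hle : ∀ m, g m ≤ lattice d)
    (hg : ∀ a b, Measurable fun m => (g m).Adj a b) (hS : ∀ z, MeasurePreserving (S z) μ μ)
    (hcov : ∀ z m a b, (g (S z m)).Adj a b ↔ (g m).Adj (a + z) (b + z)) (k : ℕ) :
    ∀ᵐ m ∂μ, ¬ IsTrifurcation (g m) k 0 := by
  classical
  have hmeas : ∀ x, MeasurableSet {m | IsTrifurcation (g m) k x} := fun x =>
    measurableSet_setOfPred.2 (measurable_isTrifurcation hg k x)
  set p := μ {m | IsTrifurcation (g m) k 0} with hp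
  have hshift : ∀ z, p ≤ μ {m | IsTrifurcation (g m) k z} := by
    intro z
    rw [hp, ← (hS z).measure_preimage (hmeas 0).nullMeasurableSet]
    exact measure_mono fun m hm => IsTrifurcation.of_shift hcov hm
  have hcount : ∀ n : ℕ, (n : ℝ≥0∞) ^ d * p ≤
      (((2 * k + 3) * n + 2) ^ d - ((2 * k + 3) * n) ^ d : ℕ) := by
    intro n
    calc (n : ℝ≥0∞) ^ d * p = ∑ z : Fin d → Fin n, p := by simp
      _ ≤ ∑ z : Fin d → Fin n, μ {m | IsTrifurcation (g m) k (cellCentre k z)} :=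
          Finset.sum_le_sum fun z _ => hshift _
      _ = ∑ z : Fin d → Fin n, ∫⁻ m, Set.indicator
            {m | IsTrifurcation (g m) k (cellCentre k z)} 1 m ∂μ :=
          Finset.sum_congr rfl fun z _ => (lintegral_indicator_one (hmeas _)).symm
      _ = ∫⁻ m, ∑ z : Fin d → Fin n, Set.indicator
            {m | IsTrifurcation (g m) k (cellCentre k z)} 1 m ∂μ :=
          (lintegral_finsetSum _ fun z _ => measurable_one.indicator (hmeas _)).symm
      _ ≤ ∫⁻ _, (((2 * k + 3) * n + 2) ^ d - ((2 * k + 3) * n) ^ d : ℕ) ∂μ := by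
          refine lintegral_mono fun m => ?_
          have := card_filter_trifurcation_le (hle m) k n
          rw [Finset.card_filter] at this
          calc _ = ((∑ z : Fin d → Fin n,
                if IsTrifurcation (g m) k (cellCentre k z) then 1 else 0 : ℕ) : ℝ≥0∞) := by
                push_cast
                rfl
            _ ≤ _ := by exact_mod_cast this
      _ = _ := by simp
  have hp0 : p.toReal ≤ 0 := by
    refine density_nonpos_of_le_boundary (d := d) (K := 2 * k + 3) fun n => ?_
    have h1 := ENNReal.toReal_mono (ENNReal.natCast_ne_top _) (hcount n)
    rw [ENNReal.toReal_mul, ENNReal.toReal_pow, ENNReal.toReal_natCast, ENNReal.toReal_natCast,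
      Nat.cast_sub (Nat.pow_le_pow_left (by omega) d)] at h1
    push_cast at h1 ⊢
    exact h1
  have : p = 0 := by
    have h1 := le_antisymm hp0 ENNReal.toReal_nonneg
    exact ((ENNReal.toReal_eq_zero_iff _).1 h1).resolve_right (measure_ne_top _ _)
  rw [ae_iff]
  simpa using this

/-- If single edges can be inserted, then all edges of a box can be inserted. -/
theorem exists_insert_box
    (hins : ∀ a b, (lattice d).Adj a b → ∃ T : X → X, Measure.QuasiMeasurePreserving T μ μ ∧
      ∀ m x y, (g (T m)).Adj x y ↔ (g m).Adj x y ∨ s(x, y) = s(a, b)) (k : ℕ) :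
    ∃ T : X → X, Measure.QuasiMeasurePreserving T μ μ ∧ ∀ m, g (T m) = g m ⊔ boxGraph 0 k := by
  classical
  have key : ∀ F : Finset ((Fin d → ℤ) × (Fin d → ℤ)), (∀ p ∈ F, (lattice d).Adj p.1 p.2) →
      ∃ T : X → X, Measure.QuasiMeasurePreserving T μ μ ∧
      ∀ m x y, (g (T m)).Adj x y ↔ (g m).Adj x y ∨ ∃ p ∈ F, s(x, y) = s(p.1, p.2) := by
    intro F
    induction F using Finset.induction_on with
    | empty => exact fun _ => ⟨id, Measure.QuasiMeasurePreserving.id μ, by simp⟩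
    | insert q F _ ih =>
      intro hF
      obtain ⟨T, hT, hgT⟩ := ih fun p hp => hF p (Finset.mem_insert_of_mem hp)
      obtain ⟨T', hT', hgT'⟩ := hins q.1 q.2 (hF q (Finset.mem_insert_self _ _))
      refine ⟨T' ∘ T, hT'.comp hT, fun m x y => ?_⟩
      rw [Function.comp_apply, hgT', hgT]
      simp only [Finset.mem_insert, exists_eq_or_imp]
      rw [or_assoc, or_comm (a := ∃ p ∈ F, _)]
  obtain ⟨T, hT, hgT⟩ := key ((box 0 k ×ˢ box 0 k).filter fun p => (lattice d).Adj p.1 p.2)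
    (fun p hp => (Finset.mem_filter.1 hp).2)
  refine ⟨T, hT, fun m => ?_⟩
  ext x y
  rw [hgT, SimpleGraph.sup_adj]
  refine or_congr_right ⟨?_, fun h => ⟨(x, y), ?_, rfl⟩⟩
  · rintro ⟨⟨a, b⟩, hp, hxy⟩
    simp only [Finset.mem_filter, Finset.mem_product] at hp
    rcases Sym2.eq_iff.1 hxy with ⟨rfl, rfl⟩ | ⟨rfl, rfl⟩
    · exact ⟨hp.2, hp.1.1, hp.1.2⟩
    · exact ⟨hp.2.symm, hp.1.2, hp.1.1⟩
  · simp only [Finset.mem_filter, Finset.mem_product]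
    exact ⟨⟨h.2.1, h.2.2⟩, h.1⟩

theorem exists_box_of_finite {ι : Type*} [Finite ι] (a : ι → Fin d → ℤ) :
    ∃ k, ∀ i, a i ∈ box 0 k := by
  cases nonempty_fintype ι
  refine ⟨∑ i, ∑ j, (a i j).natAbs, fun i => mem_box.2 fun j => ?_⟩
  have h1 : (a i j).natAbs ≤ ∑ j, (a i j).natAbs :=
    Finset.single_le_sum (f := fun j => (a i j).natAbs) (fun _ _ => Nat.zero_le _)
      (Finset.mem_univ j)
  have h2 : ∑ j, (a i j).natAbs ≤ ∑ i, ∑ j, (a i j).natAbs :=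
    Finset.single_le_sum (f := fun i => ∑ j, (a i j).natAbs) (fun _ _ => Nat.zero_le _)
      (Finset.mem_univ i)
  simp only [Pi.zero_apply]
  omega

/-- **Uniqueness of the infinite cluster** (Burton–Keane) for ergodic, insertion tolerant
percolation on the lattice. -/
theorem ae_not_twoInfinite [IsProbabilityMeasure μ] (hle : ∀ m, g m ≤ lattice d)
    (hg : ∀ a b, Measurable fun m => (g m).Adj a b) (hS : ∀ z, MeasurePreserving (S z) μ μ)
    (hcov : ∀ z m a b, (g (S z m)).Adj a b ↔ (g m).Adj (a + z) (b + z))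
    (h01 : ∀ A, MeasurableSet A → (∀ z, S z ⁻¹' A = A) → μ A = 0 ∨ μ A = 1)
    (hins : ∀ a b, (lattice d).Adj a b → ∃ T : X → X, Measure.QuasiMeasurePreserving T μ μ ∧
      ∀ m x y, (g (T m)).Adj x y ↔ (g m).Adj x y ∨ s(x, y) = s(a, b)) :
    ∀ᵐ m ∂μ, ¬ TwoInfinite (g m) := by
  choose T hT hgT using exists_insert_box hins
  -- The radius of a box meeting three given clusters depends on `m`, so all radii are treated at
  -- once.
  have h3 : ∀ᵐ m ∂μ, ¬ ThreeInfinite (g m) := by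
    have : ∀ᵐ m ∂μ, ∀ k, ¬ IsTrifurcation (g (T k m)) k 0 :=
      ae_all_iff.2 fun k => (hT k).ae (ae_not_isTrifurcation hle hg hS hcov k)
    filter_upwards [this] with m hm
    rintro ⟨a, ha, hne⟩
    obtain ⟨k, hk⟩ := exists_box_of_finite a
    refine hm k ?_
    rw [hgT]
    exact isTrifurcation_sup_boxGraph (hle m) hk ha hne
  have hmeas : MeasurableSet {m | TwoInfinite (g m)} :=
    measurableSet_setOfPred.2 (measurable_twoInfinite hg)
  have hinv : ∀ z, S z ⁻¹' {m | TwoInfinite (g m)} = {m | TwoInfinite (g m)} := fun z =>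
    Set.ext fun m => ⟨fun h => TwoInfinite.map_iso (shiftIso hcov z m) h,
      fun h => TwoInfinite.map_iso (shiftIso hcov z m).symm h⟩
  rcases h01 _ hmeas hinv with h0 | h1
  · rw [ae_iff]
    simpa using h0
  -- An almost sure event persists after opening any box, but a box that meets two infinite clusters
  -- destroys this one when there is no third.
  · have hae : ∀ᵐ m ∂μ, TwoInfinite (g m) := (mem_ae_iff_prob_eq_one hmeas).2 h1
    have : ∀ᵐ m ∂μ, ∀ k, TwoInfinite (g (T k m)) := ae_all_iff.2 fun k => (hT k).ae hae
    filter_upwards [h3, this] with m hm hmT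
    rintro ⟨a, b, ha, hb, hab⟩
    obtain ⟨k, hk⟩ := exists_box_of_finite ![a, b]
    have := hmT k
    rw [hgT] at this
    exact not_twoInfinite_sup_boxGraph hm (hk 0) (hk 1) ha hb hab this

end Percolation

/-! ### Insertion tolerance and zero-one law for product measures -/

section ProductMeasure

variable {ι α : Type*} [MeasurableSpace α] {ρ : ι → Measure α} [∀ i, IsProbabilityMeasure (ρ i)]

theorem indep_cylinderEvents {S T : Set ι} (hST : Disjoint S T) :
    Indep (cylinderEvents (X := fun _ => α) S) (cylinderEvents (X := fun _ => α) T)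
      (Measure.infinitePi ρ) :=
  indep_iSup_of_disjoint (fun i => (measurable_pi_apply i).comap_le)
    (iIndepFun_infinitePi (P := ρ) (X := fun _ ω => ω) fun _ => measurable_id) hST

/-- Setting one coordinate to an atom of its law preserves null sets of a product measure. -/
theorem quasiMeasurePreserving_update [DecidableEq ι] [MeasurableSingletonClass α] {i : ι} {c : α}
    (hc : ρ i {c} ≠ 0) :
    Measure.QuasiMeasurePreserving (fun m : ι → α => Function.update m i c)
      (Measure.infinitePi ρ) (Measure.infinitePi ρ) := by
  -- The updated configuration does not depend on the coordinate `i`, so the preimage of `B` is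
  -- independent of the event `m i = c`. On that event the update is the identity, so the
  -- intersection lies in `B`.
  have hT : Measurable[cylinderEvents (X := fun _ => α) {i}ᶜ]
      fun m : ι → α => Function.update m i c := by
    refine (@measurable_pi_iff _ _ _ (cylinderEvents (X := fun _ => α) {i}ᶜ) _ _).2 fun j => ?_
    by_cases hj : j = i
    · subst hj
      simp only [Function.update_self]
      exact measurable_const
    · simp only [Function.update_of_ne hj]
      exact measurable_cylinderEvent_apply hj
  have hT' : Measurable fun m : ι → α => Function.update m i c :=
    hT.mono cylinderEvents_le_pi le_rfl
  refine ⟨hT', Measure.AbsolutelyContinuous.mk fun B hB hB0 => ?_⟩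
  rw [Measure.map_apply hT' hB]
  have hB' : MeasurableSet[cylinderEvents (X := fun _ => α) {i}ᶜ]
      ((fun m : ι → α => Function.update m i c) ⁻¹' B) := hT hB
  have hC : MeasurableSet[cylinderEvents (X := fun _ => α) {i}]
      ((fun m : ι → α => m i) ⁻¹' {c}) :=
    measurable_cylinderEvent_apply (Set.mem_singleton i) (measurableSet_singleton c)
  have hind := (Indep_iff _ _ _).1 (indep_cylinderEvents (ρ := ρ) (S := {i}ᶜ) (T := {i})
    (Set.disjoint_left.2 fun _ h => h)) _ _ hB' hC
  have hle : Measure.infinitePi ρ ((fun m : ι → α => Function.update m i c) ⁻¹' B ∩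
      (fun m : ι → α => m i) ⁻¹' {c}) = 0 := by
    refine measure_mono_null ?_ hB0
    rintro m ⟨h1, h2⟩
    have h2' : m i = c := h2
    have h1' : Function.update m i c ∈ B := h1
    rwa [← h2', Function.update_eq_self] at h1'
  rw [hle, (measurePreserving_eval_infinitePi ρ i).measure_preimage
    (measurableSet_singleton c).nullMeasurableSet] at hind
  exact (mul_eq_zero.1 hind.symm).resolve_right hc

/-- A permutation of the coordinates that respects the laws preserves a product measure. -/
theorem measurePreserving_reindex (e : ι ≃ ι) (he : ∀ i, ρ (e i) = ρ i) :
    MeasurePreserving (fun (m : ι → α) i => m (e i)) (Measure.infinitePi ρ)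
      (Measure.infinitePi ρ) := by
  have hm : ∀ i, Measurable fun m : ι → α => m (e i) := fun i => measurable_pi_apply _
  refine ⟨measurable_pi_iff.2 hm, ?_⟩
  have hind : iIndepFun (fun i (m : ι → α) => m (e i)) (Measure.infinitePi ρ) :=
    (iIndepFun_infinitePi (P := ρ) (X := fun _ ω => ω) fun _ => measurable_id).precomp e.injective
  rw [hind.map_fun_eq_infinitePi_map hm]
  congr 1
  funext i
  rw [← he i]
  exact (measurePreserving_eval_infinitePi ρ (e i)).map_eq

/-- **Zero-one law**: an event that is invariant under permutations of the coordinates which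
displace every finite set has probability zero or one. -/
theorem measure_eq_zero_or_one_of_invariant {κ : Type*} (e : κ → ι ≃ ι)
    (he : ∀ z i, ρ (e z i) = ρ i)
    (hdisp : ∀ F : Finset ι, ∃ z, ∀ i ∈ F, e z i ∉ F) {A : Set (ι → α)} (hA : MeasurableSet A)
    (hinv : ∀ z, (fun (m : ι → α) i => m (e z i)) ⁻¹' A = A) :
    Measure.infinitePi ρ A = 0 ∨ Measure.infinitePi ρ A = 1 := by
  set μ := Measure.infinitePi ρ with hμ
  have halg : IsSetAlgebra (measurableCylinders fun _ : ι => α) :=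
    ⟨empty_mem_measurableCylinders _, fun _ h => compl_mem_measurableCylinders h,
      fun _ _ h h' => union_mem_measurableCylinders h h'⟩
  have hdense := Measure.MeasureDense.of_generateFrom_isSetAlgebra_finite μ halg
    generateFrom_measurableCylinders.symm
  -- Approximate `A` by a cylinder `C` and displace its base off itself. Then `C` and its displaced
  -- copy are independent and both close to `A`, so `μ A` is nearly `(μ A) ^ 2`.
  have key : ∀ ε : ℝ, 0 < ε → |μ.real A - μ.real A ^ 2| ≤ 4 * ε := by
    intro ε hε
    obtain ⟨C, hC, hAC⟩ := hdense.approx A hA (measure_ne_top _ _) ε hε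
    have hCm : MeasurableSet C := hdense.measurable C hC
    obtain ⟨F, S, hS, rfl⟩ := (mem_measurableCylinders C).1 hC
    obtain ⟨z, hz⟩ := hdisp F
    set f : (ι → α) → ι → α := fun m i => m (e z i) with hf
    have hfm : MeasurePreserving f μ μ := measurePreserving_reindex (e z) (he z)
    set C := cylinder (α := fun _ => α) F S
    have hCF : MeasurableSet[cylinderEvents (X := fun _ => α) (F : Set ι)] C := by
      have : Measurable[cylinderEvents (X := fun _ => α) (F : Set ι)]
          (F.restrict : (ι → α) → F → α) :=
        (@measurable_pi_iff _ _ _ (cylinderEvents (X := fun _ => α) (F : Set ι)) _ _).2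
          fun i => measurable_cylinderEvent_apply i.2
      exact this hS
    have hCF' : MeasurableSet[cylinderEvents (X := fun _ => α) (e z '' F)] (f ⁻¹' C) := by
      have : Measurable[cylinderEvents (X := fun _ => α) (e z '' F)]
          (fun (m : ι → α) => (F.restrict (f m) : F → α)) :=
        (@measurable_pi_iff _ _ _ (cylinderEvents (X := fun _ => α) (e z '' F)) _ _).2
          fun i => measurable_cylinderEvent_apply ⟨i, i.2, rfl⟩
      exact this hS
    have hind : μ (C ∩ f ⁻¹' C) = μ C * μ (f ⁻¹' C) :=
      (Indep_iff _ _ _).1 (indep_cylinderEvents (ρ := ρ) (S := F) (T := e z '' F) (Set.disjoint_left.2 (by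
        rintro _ hi ⟨j, hj, rfl⟩
        exact hz j hj hi))) _ _ hCF hCF'
    have hCC : μ.real (C ∩ f ⁻¹' C) = μ.real C ^ 2 := by
      rw [measureReal_def, hind, hfm.measure_preimage hCm.nullMeasurableSet, ENNReal.toReal_mul,
        sq, measureReal_def]
    have hr : μ.real (symmDiff A C) ≤ ε := by
      rw [measureReal_def]
      exact (ENNReal.toReal_mono ENNReal.ofReal_ne_top hAC.le).trans_eq
        (ENNReal.toReal_ofReal hε.le)
    -- Here the invariance of `A` is used: the displaced cylinder approximates `A` just as well.
    have hr' : μ.real (symmDiff A (f ⁻¹' C)) ≤ ε := by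
      have : symmDiff A (f ⁻¹' C) = f ⁻¹' symmDiff A C := by
        conv_lhs => rw [← hinv z]
        rfl
      rw [this, measureReal_def, hfm.measure_preimage (hA.symmDiff hCm).nullMeasurableSet]
      exact hr
    have hr2 : μ.real (symmDiff A (C ∩ f ⁻¹' C)) ≤ 2 * ε := by
      have hsub : symmDiff A (C ∩ f ⁻¹' C) ⊆ symmDiff A C ∪ symmDiff A (f ⁻¹' C) := by
        intro m
        simp only [Set.mem_symmDiff, Set.mem_union, Set.mem_inter_iff]
        tauto
      calc _ ≤ μ.real (symmDiff A C ∪ symmDiff A (f ⁻¹' C)) := measureReal_mono hsub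
        _ ≤ _ := measureReal_union_le _ _
        _ ≤ _ := by linarith
    have h1 := (abs_measureReal_sub_le_measureReal_symmDiff hA.nullMeasurableSet
      hCm.nullMeasurableSet (μ := μ)).trans hr
    have h2 := (abs_measureReal_sub_le_measureReal_symmDiff hA.nullMeasurableSet
      (hCm.inter (hfm.measurable hCm)).nullMeasurableSet (μ := μ)).trans hr2
    rw [hCC] at h2
    have hA1 : μ.real A ≤ 1 := measureReal_le_one
    have hC1 : μ.real C ≤ 1 := measureReal_le_one
    have hA0 : 0 ≤ μ.real A := measureReal_nonneg
    have hC0 : 0 ≤ μ.real C := measureReal_nonneg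
    have h3 : |μ.real C ^ 2 - μ.real A ^ 2| ≤ 2 * ε := by
      rw [sq_sub_sq, abs_mul, abs_sub_comm]
      refine mul_le_mul ?_ h1 (abs_nonneg _) zero_le_two
      rw [abs_of_nonneg (by linarith)]
      linarith
    calc |μ.real A - μ.real A ^ 2|
        = |(μ.real A - μ.real C ^ 2) + (μ.real C ^ 2 - μ.real A ^ 2)| := by congr 1; ring
      _ ≤ _ := abs_add_le _ _
      _ ≤ 4 * ε := by linarith
  have h0 : μ.real A - μ.real A ^ 2 = 0 := by
    refine abs_nonpos_iff.1 (le_of_forall_pos_le_add fun ε hε => ?_)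
    have := key (ε / 4) (by positivity)
    linarith
  have h1 : μ.real A * (1 - μ.real A) = 0 := by linear_combination h0
  rcases mul_eq_zero.1 h1 with h | h
  · exact Or.inl ((measureReal_eq_zero_iff).1 h)
  · refine Or.inr ?_
    have h2 : μ.real A = 1 := by linarith
    rw [← ofReal_measureReal (μ := μ) (s := A), h2, ENNReal.ofReal_one]

end ProductMeasure

/-! ### Loops, their masses and the open graph -/

section Loops

variable {V : Type*}

instance [Countable V] : Countable (BasedLoop V) :=
  inferInstanceAs (Countable {l : List V // 2 ≤ l.length ∧
    List.Forall₂ (fun x y => x ≠ y) l (l.rotate 1)})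

instance [Countable V] : Countable (Loop V) :=
  inferInstanceAs (Countable (Quotient (BasedLoop.setoid V)))

instance : DiscreteMeasurableSpace (BasedLoop V) := ⟨fun _ => trivial⟩

instance : DiscreteMeasurableSpace (Loop V) := ⟨fun _ => trivial⟩

/-- The image of a based loop under a permutation of the vertices. -/
def BasedLoop.map (e : V ≃ V) (b : BasedLoop V) : BasedLoop V :=
  ⟨b.1.map e, by simpa using b.2.1, by
    rw [← List.map_rotate, List.forall₂_map_left_iff, List.forall₂_map_right_iff]
    simpa using b.2.2⟩

/-- A permutation of the vertices acts by permutations on based loops. -/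
def BasedLoop.mapEquiv (e : V ≃ V) : BasedLoop V ≃ BasedLoop V where
  toFun := BasedLoop.map e
  invFun := BasedLoop.map e.symm
  left_inv b := Subtype.ext (by simp [BasedLoop.map])
  right_inv b := Subtype.ext (by simp [BasedLoop.map])

/-- A permutation of the vertices acts by permutations on loops. -/
def Loop.mapEquiv (e : V ≃ V) : Loop V ≃ Loop V :=
  Quotient.congr (BasedLoop.mapEquiv e) fun a b => by
    change a.1.IsRotated b.1 ↔ (a.1.map e).IsRotated (b.1.map e)
    refine ⟨fun h => h.map e, fun h => ?_⟩
    simpa using h.map e.symm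

theorem BasedLoop.toLoop_eq_iff {b b' : BasedLoop V} : b.toLoop = b'.toLoop ↔ b.1.IsRotated b'.1 :=
  Quotient.eq

theorem BasedLoop.toLoop_map (e : V ≃ V) (b : BasedLoop V) :
    (BasedLoop.mapEquiv e b).toLoop = Loop.mapEquiv e b.toLoop := rfl

theorem BasedLoop.steps_map (e : V ≃ V) (b : BasedLoop V) :
    (BasedLoop.mapEquiv e b).steps = b.steps.map (Prod.map e e) := by
  change (b.1.map e).zip ((b.1.map e).rotate 1) = _
  rw [← List.map_rotate, List.zip_map]
  rfl

theorem BasedLoop.weight_map {Q : V → V → ℝ} (e : V ≃ V) (hQ : ∀ x y, Q (e x) (e y) = Q x y)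
    (κ : ℝ) (b : BasedLoop V) : (BasedLoop.mapEquiv e b).weight Q κ = b.weight Q κ := by
  have hlen : (BasedLoop.mapEquiv e b).1.length = b.1.length := List.length_map _
  simp only [BasedLoop.weight, hlen, BasedLoop.steps_map, List.map_map]
  congr 3
  funext p
  exact hQ _ _

theorem Loop.Traverses.map {e : V ≃ V} {ℓ : Loop V} {x y : V} (h : ℓ.Traverses s(x, y)) :
    (Loop.mapEquiv e ℓ).Traverses s(e x, e y) := by
  obtain ⟨b, rfl, p, hp, hpe⟩ := h
  refine ⟨BasedLoop.mapEquiv e b, rfl, Prod.map e e p, ?_, ?_⟩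
  · rw [BasedLoop.steps_map]
    exact List.mem_map_of_mem hp
  · have := congrArg (Sym2.map e) hpe
    simpa using this

theorem Loop.traverses_map_iff {e : V ≃ V} {ℓ : Loop V} {x y : V} :
    (Loop.mapEquiv e ℓ).Traverses s(e x, e y) ↔ ℓ.Traverses s(x, y) := by
  refine ⟨fun h => ?_, Loop.Traverses.map⟩
  have h' := h.map (e := e.symm)
  have hid : Loop.mapEquiv e.symm (Loop.mapEquiv e ℓ) = ℓ :=
    (Loop.mapEquiv e).symm_apply_apply ℓ
  simpa [hid] using h'

theorem BasedLoop.finite_toLoop_fiber (ℓ : Loop V) : {b : BasedLoop V | b.toLoop = ℓ}.Finite := by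
  obtain ⟨b, rfl⟩ := Quotient.exists_rep ℓ
  refine Set.Finite.of_finite_image (f := Subtype.val) ?_ Subtype.val_injective.injOn
  refine (List.finite_toSet b.1.cyclicPermutations).subset ?_
  rintro _ ⟨b', hb', rfl⟩
  exact List.mem_cyclicPermutations_iff.2 (BasedLoop.toLoop_eq_iff.1 hb')

open Classical in
theorem loopMeasure_singleton (Q : V → V → ℝ) (κ : ℝ) (ℓ : Loop V) :
    loopMeasure Q κ {ℓ} =
      ∑' b : BasedLoop V, if b.toLoop = ℓ then ENNReal.ofReal (b.weight Q κ) else 0 := by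
  rw [loopMeasure, Measure.map_apply measurable_from_top (measurableSet_singleton ℓ),
    basedLoopMeasure, Measure.sum_apply _ .of_discrete]
  refine tsum_congr fun b => ?_
  rw [Measure.smul_apply, Measure.dirac_apply' _ .of_discrete]
  by_cases h : b.toLoop = ℓ <;> simp [h]

/-- The sum runs over the rotations of one list. Finiteness makes the multiplicity of each loop a
genuine Poisson variable, without any bound on the total mass. -/
theorem loopMeasure_singleton_lt_top (Q : V → V → ℝ) (κ : ℝ) (ℓ : Loop V) :
    loopMeasure Q κ {ℓ} < ∞ := by
  classical
  rw [loopMeasure_singleton, tsum_eq_sum (s := (BasedLoop.finite_toLoop_fiber ℓ).toFinset)]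
  · refine ENNReal.sum_lt_top.2 fun b _ => ?_
    split_ifs
    · exact ENNReal.ofReal_lt_top
    · exact ENNReal.zero_lt_top
  · intro b hb
    rw [if_neg (by simpa using hb)]

theorem loopMeasure_singleton_map {Q : V → V → ℝ} (e : V ≃ V) (hQ : ∀ x y, Q (e x) (e y) = Q x y)
    (κ : ℝ) (ℓ : Loop V) : loopMeasure Q κ {Loop.mapEquiv e ℓ} = loopMeasure Q κ {ℓ} := by
  classical
  rw [loopMeasure_singleton, loopMeasure_singleton, ← (BasedLoop.mapEquiv e).tsum_eq]
  refine tsum_congr fun b => ?_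
  rw [BasedLoop.toLoop_map, BasedLoop.weight_map e hQ]
  simp only [EmbeddingLike.apply_eq_iff_eq]

theorem loopMeasure_toLoop_pos {Q : V → V → ℝ} {κ : ℝ} {b : BasedLoop V} (hb : 0 < b.weight Q κ) :
    0 < loopMeasure Q κ {b.toLoop} := by
  classical
  rw [loopMeasure_singleton]
  refine lt_of_lt_of_le (ENNReal.ofReal_pos.2 hb) ?_
  refine le_trans (le_of_eq ?_) (ENNReal.le_tsum b)
  rw [if_pos rfl]

/-- The based loop that crosses an edge back and forth. -/
def edgeLoop (a b : V) (h : a ≠ b) : BasedLoop V :=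
  ⟨[a, b], le_rfl, by simp [h, h.symm]⟩

theorem edgeLoop_traverses_iff {a b : V} (h : a ≠ b) {s : Sym2 V} :
    (edgeLoop a b h).toLoop.Traverses s ↔ s = s(a, b) := by
  constructor
  · rintro ⟨c, hc, p, hp, rfl⟩
    have hmem : c.1 ∈ [a, b].cyclicPermutations :=
      List.mem_cyclicPermutations_iff.2 (BasedLoop.toLoop_eq_iff.1 hc)
    have hcases : c.1 = [a, b] ∨ c.1 = [b, a] := by
      simpa [List.cyclicPermutations] using hmem
    rcases hcases with h' | h' <;> simp [BasedLoop.steps, h'] at hp <;>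
      rcases hp with rfl | rfl <;> simp [Sym2.eq_swap]
  · rintro rfl
    exact ⟨edgeLoop a b h, rfl, (a, b), by simp [BasedLoop.steps, edgeLoop], rfl⟩

theorem openGraph_le (G : SimpleGraph V) (m : Loop V → ℕ) : openGraph G m ≤ G := fun _ _ h => h.1

open Classical in
/-- Inserting the loop that crosses an edge back and forth opens exactly this edge. -/
theorem openGraph_update_adj {G : SimpleGraph V} {a b : V} (hab : G.Adj a b) (m : Loop V → ℕ)
    (x y : V) : (openGraph G (Function.update m (edgeLoop a b hab.ne).toLoop 1)).Adj x y ↔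
      (openGraph G m).Adj x y ∨ s(x, y) = s(a, b) := by
  set ℓ₀ := (edgeLoop a b hab.ne).toLoop with hℓ₀
  constructor
  · rintro ⟨hxy, ℓ, hℓ, htr⟩
    by_cases h : ℓ = ℓ₀
    · subst h
      exact Or.inr ((edgeLoop_traverses_iff hab.ne).1 htr)
    · rw [Function.update_of_ne h] at hℓ
      exact Or.inl ⟨hxy, ℓ, hℓ, htr⟩
  -- Overwriting an earlier multiplicity by one closes no edge, since only its being nonzero
  -- matters.
  · rintro (⟨hxy, ℓ, hℓ, htr⟩ | h)
    · refine ⟨hxy, ℓ, ?_, htr⟩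
      by_cases h : ℓ = ℓ₀
      · rw [h, Function.update_self]
        exact one_ne_zero
      · rwa [Function.update_of_ne h]
    · refine ⟨?_, ℓ₀, ?_, (edgeLoop_traverses_iff hab.ne).2 h⟩
      · rcases Sym2.eq_iff.1 h with ⟨rfl, rfl⟩ | ⟨rfl, rfl⟩
        · exact hab
        · exact hab.symm
      · rw [Function.update_self]
        exact one_ne_zero

theorem measurable_openGraph_adj [Countable V] (G : SimpleGraph V) (x y : V) :
    Measurable fun m : Loop V → ℕ => (openGraph G m).Adj x y := by
  refine measurable_const.and (Measurable.exists fun ℓ => Measurable.and ?_ measurable_const)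
  exact (measurable_from_top (f := fun n : ℕ => n ≠ 0)).comp (measurable_pi_apply ℓ)

theorem openGraph_reindex_adj {G : SimpleGraph V} (e : V ≃ V)
    (he : ∀ x y, G.Adj (e x) (e y) ↔ G.Adj x y) (m : Loop V → ℕ) (x y : V) :
    (openGraph G fun ℓ => m (Loop.mapEquiv e ℓ)).Adj x y ↔ (openGraph G m).Adj (e x) (e y) := by
  refine and_congr (he x y).symm ⟨?_, ?_⟩
  · rintro ⟨ℓ, hℓ, htr⟩
    exact ⟨_, hℓ, htr.map⟩
  · rintro ⟨ℓ, hℓ, htr⟩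
    obtain ⟨ℓ, rfl⟩ := (Loop.mapEquiv e).surjective ℓ
    exact ⟨ℓ, hℓ, Loop.traverses_map_iff.1 htr⟩

theorem infiniteClusters_subsingleton {G : SimpleGraph V} {m : Loop V → ℕ}
    (h : ¬ TwoInfinite (openGraph G m)) : (infiniteClusters G m).Subsingleton := by
  rintro _ ⟨hi, c, rfl⟩ _ ⟨hi', c', rfl⟩
  induction c using SimpleGraph.ConnectedComponent.ind with | _ a
  induction c' using SimpleGraph.ConnectedComponent.ind with | _ b
  have hsupp : ∀ a, InInfinite (openGraph G m) a ↔
      ((openGraph G m).connectedComponentMk a).supp.Infinite := by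
    intro a
    have : {v | (openGraph G m).Reachable a v} = ((openGraph G m).connectedComponentMk a).supp := by
      ext v
      rw [SimpleGraph.ConnectedComponent.mem_supp_iff, SimpleGraph.ConnectedComponent.eq]
      exact SimpleGraph.reachable_comm
    rw [InInfinite, this]
  by_contra hne
  exact h ⟨a, b, (hsupp a).2 hi, (hsupp b).2 hi', fun hab =>
    hne (by rw [SimpleGraph.ConnectedComponent.sound hab])⟩

theorem pointMeasure_singleton (m : Loop V → ℕ) (ℓ : Loop V) : pointMeasure m {ℓ} = m ℓ := by
  classical
  rw [pointMeasure, Measure.sum_apply _ .of_discrete, tsum_eq_single ℓ]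
  · simp
  · intro ℓ' h
    simp [h]

end Loops

/-! ### Translations of lattice loops -/

section LatticeLoops

variable {d : ℕ}

theorem lattice_adj_add (z x y : Fin d → ℤ) :
    (lattice d).Adj (x + z) (y + z) ↔ (lattice d).Adj x y := by
  change ∑ i, |(x + z) i - (y + z) i| = 1 ↔ ∑ i, |x i - y i| = 1
  simp

theorem srw_add (z x y : Fin d → ℤ) : srw d (x + z) (y + z) = srw d x y := by
  classical
  exact if_congr (lattice_adj_add z x y) rfl rfl

/-- The translation by `z` of loops on the lattice. -/
def translate (z : Fin d → ℤ) : Loop (Fin d → ℤ) ≃ Loop (Fin d → ℤ) :=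
  Loop.mapEquiv (Equiv.addRight z)

/-- Finitely many loops can be translated away from each other. -/
theorem exists_translate_notMem (hd : 1 ≤ d) (F : Finset (Loop (Fin d → ℤ))) :
    ∃ z, ∀ ℓ ∈ F, translate z ℓ ∉ F := by
  classical
  set U : Finset (Fin d → ℤ) := F.biUnion fun ℓ => (Quotient.out ℓ).1.toFinset
  obtain ⟨k, hk⟩ := exists_box_of_finite (fun x : U => x.1)
  -- All vertices of the loops in `F` have coordinates in `[-k, k]`, and a shift by `2 * k + 1`
  -- leaves this interval.
  refine ⟨fun _ => 2 * k + 1, fun ℓ hℓ hmem => ?_⟩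
  set z : Fin d → ℤ := fun _ => 2 * k + 1
  set b : BasedLoop (Fin d → ℤ) := Quotient.out ℓ with hb
  have hbℓ : b.toLoop = ℓ := Quotient.out_eq ℓ
  obtain ⟨x, hx⟩ : ∃ x, x ∈ b.1 :=
    List.exists_mem_of_length_pos (lt_of_lt_of_le Nat.zero_lt_two b.2.1)
  have hxU : x ∈ U := Finset.mem_biUnion.2 ⟨ℓ, hℓ, by simpa using hx⟩
  have hrot : (BasedLoop.mapEquiv (Equiv.addRight z) b).1.IsRotated
      (Quotient.out (translate z ℓ)).1 := by
    refine BasedLoop.toLoop_eq_iff.1 ?_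
    rw [BasedLoop.toLoop_map, hbℓ]
    exact (Quotient.out_eq (translate z ℓ)).symm
  have hxz : x + z ∈ (BasedLoop.mapEquiv (Equiv.addRight z) b).1 :=
    List.mem_map_of_mem (f := Equiv.addRight z) hx
  have hxzU : x + z ∈ U :=
    Finset.mem_biUnion.2 ⟨_, hmem, List.mem_toFinset.2 (hrot.mem_iff.1 hxz)⟩
  have h1 := mem_box.1 (hk ⟨x, hxU⟩) ⟨0, hd⟩
  have h2 := mem_box.1 (hk ⟨x + z, hxzU⟩) ⟨0, hd⟩
  simp only [Pi.add_apply, Pi.zero_apply, z] at h1 h2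
  omega

theorem weight_edgeLoop_pos (hd : 1 ≤ d) {κ : ℝ} (hκ : -1 < κ) {a b : Fin d → ℤ}
    (hab : (lattice d).Adj a b) : 0 < (edgeLoop a b hab.ne).weight (srw d) κ := by
  have h1 : (0 : ℝ) < 1 + κ := by linarith
  have h2 : (0 : ℝ) < d := by exact_mod_cast hd
  simp only [BasedLoop.weight, BasedLoop.steps, edgeLoop, srw, List.rotate_cons_succ,
    List.rotate_zero, List.cons_append, List.nil_append, List.zip_cons_cons, List.zip_nil_right,
    List.map_cons, List.map_nil, List.prod_cons, List.prod_nil, hab, hab.symm, if_true,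
    List.length_cons, List.length_nil]
  positivity

end LatticeLoops

/-! ### From the Poisson random measure to independent multiplicities -/

section Poisson

variable {Ω V : Type*} [MeasurableSpace Ω] {P : Measure Ω} {Q : V → V → ℝ} {α κ : ℝ}
  {L : Ω → Loop V → ℕ}

/-- The expected multiplicity of a loop in the Poisson loop ensemble. -/
noncomputable def loopRate (Q : V → V → ℝ) (α κ : ℝ) (ℓ : Loop V) : NNReal :=
  ((ENNReal.ofReal α • loopMeasure Q κ) {ℓ}).toNNReal

theorem loopRate_pos (hα : 0 < α) {b : BasedLoop V} (hb : 0 < b.weight Q κ) :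
    0 < loopRate Q α κ b.toLoop := by
  rw [loopRate, ENNReal.toNNReal_pos_iff]
  simp only [Measure.smul_apply, smul_eq_mul]
  exact ⟨ENNReal.mul_pos (ENNReal.ofReal_pos.2 hα).ne' (loopMeasure_toLoop_pos hb).ne',
    ENNReal.mul_lt_top ENNReal.ofReal_lt_top (loopMeasure_singleton_lt_top _ _ _)⟩

/-- This measurable left inverse of the cast from `ℕ` transfers measurability, laws and independence
from the values of the point measure to the multiplicities. -/
theorem measurable_floor_toReal : Measurable fun x : ℝ≥0∞ => ⌊x.toReal⌋₊ :=
  Nat.measurable_floor.comp ENNReal.measurable_toReal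

theorem floor_toReal_pointMeasure (m : Loop V → ℕ) (ℓ : Loop V) :
    ⌊(pointMeasure m {ℓ}).toReal⌋₊ = m ℓ := by
  rw [pointMeasure_singleton, ENNReal.toReal_natCast, Nat.floor_natCast]

theorem IsPoissonLoopEnsemble.measurable_apply (hL : IsPoissonLoopEnsemble P Q α κ L)
    (ℓ : Loop V) : Measurable fun ω => L ω ℓ := by
  have := measurable_floor_toReal.comp (hL.measurable {ℓ} .of_discrete)
  simpa only [Function.comp_def, floor_toReal_pointMeasure] using this

theorem IsPoissonLoopEnsemble.map_apply (hL : IsPoissonLoopEnsemble P Q α κ L) (ℓ : Loop V) :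
    P.map (fun ω => L ω ℓ) = poissonMeasure (loopRate Q α κ ℓ) := by
  have h := hL.law_of_lt_top {ℓ} .of_discrete (by
    simp only [Measure.smul_apply, smul_eq_mul]
    exact ENNReal.mul_lt_top ENNReal.ofReal_lt_top (loopMeasure_singleton_lt_top _ _ _))
  have h' := congrArg (Measure.map fun x : ℝ≥0∞ => ⌊x.toReal⌋₊) h
  rw [Measure.map_map measurable_floor_toReal (hL.measurable {ℓ} .of_discrete),
    Measure.map_map measurable_floor_toReal measurable_from_top] at h'
  simp only [Function.comp_def, floor_toReal_pointMeasure, ENNReal.toReal_natCast,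
    Nat.floor_natCast, Measure.map_id'] at h'
  exact h'

theorem IsPoissonLoopEnsemble.iIndepFun (hL : IsPoissonLoopEnsemble P Q α κ L) :
    iIndepFun (fun ℓ ω => L ω ℓ) P := by
  rw [iIndepFun_iff_finset]
  intro s
  have h := hL.indep s.card (fun i => {(s.equivFin.symm i : Loop V)}) (fun _ => .of_discrete) (by
    intro i j hij
    refine Set.disjoint_singleton.2 fun h => hij (s.equivFin.symm.injective (Subtype.ext h)))
  have h' := (h.precomp s.equivFin.injective).comp (fun _ x => ⌊x.toReal⌋₊)
    fun _ => measurable_floor_toReal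
  simp only [Function.comp_def, Equiv.symm_apply_apply, floor_toReal_pointMeasure] at h'
  exact h'

/-- The multiplicities of the loops in the Poisson loop ensemble are independent Poisson random
variables. -/
theorem IsPoissonLoopEnsemble.map_eq_infinitePi [IsProbabilityMeasure P]
    (hL : IsPoissonLoopEnsemble P Q α κ L) :
    P.map L = Measure.infinitePi fun ℓ => poissonMeasure (loopRate Q α κ ℓ) := by
  have h := hL.iIndepFun.map_fun_eq_infinitePi_map hL.measurable_apply
  simp only [hL.map_apply] at h
  exact h

end Poisson

end LoopSoup

/-! ### Uniqueness for the loop ensemble -/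

theorem mainTheorem9 (d : ℕ) (hd : 1 ≤ d) (α κ : ℝ) (hα : 0 < α) (hκ : -1 < κ)
    {Ω : Type*} [MeasurableSpace Ω] (P : Measure Ω) [IsProbabilityMeasure P]
    (L : Ω → LoopSoup.Loop (Fin d → ℤ) → ℕ)
    (hL : LoopSoup.IsPoissonLoopEnsemble P (LoopSoup.srw d) α κ L) :
    ∀ᵐ ω ∂P, (LoopSoup.infiniteClusters (LoopSoup.lattice d) (L ω)).Subsingleton := by
  classical
  have hLm : Measurable L := measurable_pi_iff.2 hL.measurable_apply
  have hrate : ∀ (z : Fin d → ℤ) ℓ, LoopSoup.loopRate (LoopSoup.srw d) α κ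
      (LoopSoup.translate z ℓ) = LoopSoup.loopRate (LoopSoup.srw d) α κ ℓ := by
    intro z ℓ
    simp only [LoopSoup.loopRate, Measure.smul_apply]
    rw [LoopSoup.translate, LoopSoup.loopMeasure_singleton_map _ fun x y => LoopSoup.srw_add z x y]
  have hae := LoopSoup.ae_not_twoInfinite
    (μ := Measure.infinitePi fun ℓ => poissonMeasure (LoopSoup.loopRate (LoopSoup.srw d) α κ ℓ))
    (g := LoopSoup.openGraph (LoopSoup.lattice d))
    (S := fun z m ℓ => m (LoopSoup.translate z ℓ))
    (LoopSoup.openGraph_le _) (LoopSoup.measurable_openGraph_adj _)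
    (fun z => LoopSoup.measurePreserving_reindex _ fun ℓ => by rw [hrate])
    (fun z m a b => LoopSoup.openGraph_reindex_adj (Equiv.addRight z)
      (LoopSoup.lattice_adj_add z) m a b)
    (fun A hA hinv => LoopSoup.measure_eq_zero_or_one_of_invariant LoopSoup.translate
      (fun z ℓ => by rw [hrate]) (LoopSoup.exists_translate_notMem hd) hA hinv)
    -- The value 1 is an atom of the Poisson law because the back-and-forth loop on an edge has
    -- positive rate.
    (fun a b hab => ⟨_, LoopSoup.quasiMeasurePreserving_update (c := 1) ?_,
      LoopSoup.openGraph_update_adj hab⟩)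
  · rw [← hL.map_eq_infinitePi] at hae
    filter_upwards [ae_of_ae_map hLm.aemeasurable hae] with ω hω
    exact LoopSoup.infiniteClusters_subsingleton hω
  · have hpos := LoopSoup.loopRate_pos hα (LoopSoup.weight_edgeLoop_pos hd hκ hab)
    rw [poissonMeasure_singleton]
    refine (ENNReal.ofReal_pos.2 ?_).ne'
    positivity
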